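/- Let $q$ be a nonzero real number. For a graph with adjacency matrix $A$ and a real potential $\eta$ on its vertices, let $\Delta$ be the diagonal matrix whose entry at a vertex $v$ is the sum of the $v$-th row of $A$ plus $\eta(v)$, let $L=\Delta-A$, and let the $q$-Laplacian matrix be $\mathscr{L}=qL-(q-1)I+q(q-1)(\Delta-I)$. Put $U(t)=\exp(it\mathscr{L})$ for $t\in\mathbb{R}$. The graph exhibits vertex perfect state transfer (vertex PST) with respect to $\mathscr{L}$ if there are two distinct vertices $a,b$ and a time $\tau>0$ such that $\mathbf{e}_b\mathbf{e}_b^T=U(\tau)\,\mathbf{e}_a\mathbf{e}_a^T\,U(-\tau)$ (equivalently, $U(\tau)\mathbf{e}_a=\gamma\,\mathbf{e}_b$ for some $\gamma\in\mathbb{C}$), where $\mathbf{e}_v$ is the characteristic vector of the vertex $v$. Let $P_n(\omega_1,\omega_2)$ denote the path on $n$ vertices, all edges having weight $1$, with potentials $\omega_1$ and $\omega_2$ at its first and last vertex respectively and potential $0$ at every other vertex. Then $P_n(\omega_1,\omega_2)$ does not exhibit vertex PST with respect to its $q$-Laplacian matrix in any of the following cases: 1. $n\ge 2$, $\omega_1=1+\frac1q$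 and $\omega_2=1$; 2. $n\ge 4$ and $\omega_1=\omega_2=1$; 3. $n\ge 5$ and $\omega_1=\omega_2=1+\frac1q$. -/

import Mathlib

noncomputable section

namespace QLaplacianWalk

open Matrix

/-- The degree matrix, with potential, of a weighted graph on `V` with adjacency matrix `A`
(`A u v` is the weight of the edge `uv`, and `0` if there is none) and potential `η` on the
vertices: the diagonal matrix of the row sums of `A`, plus the diagonal matrix of `η`. -/
def degreeMatrix {V : Type*} [Fintype V] [DecidableEq V] (A : Matrix V V ℝ) (η : V → ℝ) :
    Matrix V V ℝ :=
  diagonal (fun v => ∑ w, A v w) + diagonal η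

/-- The Laplacian matrix, with potential, `L = Δ - A`. -/
def laplacian {V : Type*} [Fintype V] [DecidableEq V] (A : Matrix V V ℝ) (η : V → ℝ) :
    Matrix V V ℝ :=
  degreeMatrix A η - A

/-- The `q`-Laplacian matrix `q L - (q - 1) I + q (q - 1) (Δ - I)`, with potential. -/
def qLaplacian {V : Type*} [Fintype V] [DecidableEq V] (q : ℝ) (A : Matrix V V ℝ) (η : V → ℝ) :
    Matrix V V ℝ :=
  q • laplacian A η - (q - 1) • (1 : Matrix V V ℝ) + (q * (q - 1)) • (degreeMatrix A η - 1)

/-- The transition matrix `U(t) = exp (i t M)` of the continuous-time quantum walk relative to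
the real matrix `M`. -/
def transitionMatrix {V : Type*} [Fintype V] [DecidableEq V] (M : Matrix V V ℝ) (t : ℝ) :
    Matrix V V ℂ :=
  NormedSpace.exp ((Complex.I * (t : ℂ)) • M.map Complex.ofReal)

/-- The density matrix `D_x = x xᵀ` of a real vector `x`. -/
def density {V : Type*} (x : V → ℝ) : Matrix V V ℂ :=
  (vecMulVec x x).map Complex.ofReal

/-- Perfect state transfer relative to `M` from `D₁` to `D₂` at time `τ`:
`D₂ = U(τ) D₁ U(-τ)`, with `τ > 0`. -/
def PSTAt {V : Type*} [Fintype V] [DecidableEq V] (M : Matrix V V ℝ) (D₁ D₂ : Matrix V V ℂ)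
    (τ : ℝ) : Prop :=
  0 < τ ∧ D₂ = transitionMatrix M τ * D₁ * transitionMatrix M (-τ)

/-- `M` exhibits vertex PST: at some time there is perfect state transfer between the vertex
states of two distinct vertices. (Transfer from a state to itself is periodicity.) -/
def ExhibitsVertexPST {V : Type*} [Fintype V] [DecidableEq V] (M : Matrix V V ℝ) : Prop :=
  ∃ a b : V, a ≠ b ∧
    ∃ τ : ℝ, PSTAt M (density (Pi.single a 1)) (density (Pi.single b 1)) τ

open Classical in
/-- The adjacency matrix of the (unweighted) path on the `n` vertices `0, 1, …, n - 1`. -/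
def pathAdj (n : ℕ) : Matrix (Fin n) (Fin n) ℝ :=
  (SimpleGraph.pathGraph n).adjMatrix ℝ

/-- The potential on the path with value `ω₁` at the first vertex, `ω₂` at the last one, and `0`
at all other vertices. -/
def endPotential (n : ℕ) (ω₁ ω₂ : ℝ) (v : Fin n) : ℝ :=
  (if v.val = 0 then ω₁ else 0) + (if v.val + 1 = n then ω₂ else 0)

/-- The `q`-Laplacian matrix of `P_n(ω₁, ω₂)`, the path on `n` vertices with potentials `ω₁` and
`ω₂` at its end vertices. -/
def pathQLaplacian (q : ℝ) (n : ℕ) (ω₁ ω₂ : ℝ) : Matrix (Fin n) (Fin n) ℝ :=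
  qLaplacian q (pathAdj n) (endPotential n ω₁ ω₂)

end QLaplacianWalk

end

open Matrix

namespace QLaplacianWalk

/-! ### Eigenvectors under perfect state transfer -/

section TransitionMatrix

variable {V : Type*} [Fintype V] [DecidableEq V]

/-! Transfer from `a` to `b` forces `v a ^ 2 = v b ^ 2` for every eigenvector `v`, and makes
differences of eigenvalues whose eigenvectors do not vanish at `a` integer multiples of `π / τ`.

An end potential `1 + ε / q` turns the end row into a ghost-vertex condition, so sine waves are
eigenvectors with eigenvalue `q ^ 2 + 1 - 2 * q * cos x`. In the mixed case one wave has entries of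
pairwise distinct modulus. In the symmetric cases the lowest frequency `x` shows that `a` is not the
middle vertex, so the waves `x`, `2x` and one of `3x`, `4x` are nonzero at `a`. With an auxiliary
wave `π - x` or `π`, commensurability gives polynomial relations over `ℚ` for `l = 2 cos x`,
contradicting the irrationality of `l` (Niven) or its size. -/

theorem exp_mulVec_of_mulVec_eq_smul {X : Matrix V V ℂ} {v : V → ℂ} {c : ℂ}
    (h : X *ᵥ v = c • v) : NormedSpace.exp X *ᵥ v = Complex.exp c • v := by
  let _ : NormedRing (Matrix V V ℂ) := Matrix.linftyOpNormedRing
  let _ : NormedAlgebra ℂ (Matrix V V ℂ) := Matrix.linftyOpNormedAlgebra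
  have hpow : ∀ k : ℕ, X ^ k *ᵥ v = c ^ k • v := by
    intro k
    induction k with
    | zero => simp
    | succ k ih => rw [pow_succ, ← mulVec_mulVec, h, mulVec_smul, ih, smul_smul, pow_succ']
  have hX := NormedSpace.exp_series_hasSum_exp' (𝕂 := ℂ) X
  have hc := NormedSpace.exp_series_hasSum_exp' (𝕂 := ℂ) c
  rw [← Complex.exp_eq_exp_ℂ] at hc
  have h₁ := hX.map ((Matrix.mulVecBilin ℂ ℂ).flip v : Matrix V V ℂ →ₗ[ℂ] V → ℂ)
    (LinearMap.continuous_of_finiteDimensional _)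
  have h₂ := hc.smul_const v
  refine h₁.unique ?_
  convert! h₂ using 1
  funext k
  simp [hpow, smul_smul]

theorem transitionMatrix_mulVec {M : Matrix V V ℝ} {v : V → ℝ} {μ : ℝ} (h : M *ᵥ v = μ • v)
    (t : ℝ) : transitionMatrix M t *ᵥ (fun k => (v k : ℂ)) =
      Complex.exp (Complex.I * t * μ) • fun k => (v k : ℂ) := by
  refine exp_mulVec_of_mulVec_eq_smul ?_
  have h' : M.map Complex.ofReal *ᵥ (fun k => (v k : ℂ)) = (μ : ℂ) • fun k => (v k : ℂ) := by
    funext k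
    have := congrArg Complex.ofReal (congrFun h k)
    simpa [mulVec, dotProduct] using this
  rw [smul_mulVec, h', smul_smul]

theorem transitionMatrix_transpose {M : Matrix V V ℝ} (hM : M.IsSymm) (t : ℝ) :
    (transitionMatrix M t)ᵀ = transitionMatrix M t := by
  rw [transitionMatrix, ← exp_transpose, transpose_smul, ← transpose_map, hM.eq]

theorem dotProduct_density_single_mulVec (a : V) (v w : V → ℂ) :
    v ⬝ᵥ (density (Pi.single a 1) *ᵥ w) = v a * w a := by
  have : density (Pi.single a 1) =
      vecMulVec (Pi.single a (1 : ℂ)) (Pi.single a (1 : ℂ)) := by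
    ext i j
    simp only [density, map_apply, vecMulVec_apply, Pi.single_apply]
    split_ifs <;> simp
  rw [this, vecMulVec_mulVec]
  simp [mul_comm]

/-- Perfect state transfer relates the entries of any two eigenvectors at the two vertices. -/
theorem PSTAt.eigenvector_mul {M : Matrix V V ℝ} (hM : M.IsSymm) {a b : V} {τ : ℝ}
    (h : PSTAt M (density (Pi.single a 1)) (density (Pi.single b 1)) τ)
    {v w : V → ℝ} {μ ν : ℝ} (hv : M *ᵥ v = μ • v) (hw : M *ᵥ w = ν • w) :
    ((v b * w b : ℝ) : ℂ) = Complex.exp ((τ * (μ - ν) : ℝ) * Complex.I) * (v a * w a : ℝ) := by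
  have hb := dotProduct_density_single_mulVec b (fun k => (v k : ℂ)) (fun k => (w k : ℂ))
  -- `U(τ)` is symmetric, so `v` is also a left eigenvector and each side contributes a phase.
  rw [h.2, ← mulVec_mulVec, ← mulVec_mulVec, transitionMatrix_mulVec hw, dotProduct_mulVec,
    ← mulVec_transpose, transitionMatrix_transpose hM, transitionMatrix_mulVec hv, mulVec_smul,
    smul_dotProduct, dotProduct_smul, dotProduct_density_single_mulVec, smul_smul,
    ← Complex.exp_add, smul_eq_mul] at hb
  push_cast
  rw [← hb]
  congr 2
  push_cast
  ring

theorem PSTAt.eigenvector_sq {M : Matrix V V ℝ} (hM : M.IsSymm) {a b : V} {τ : ℝ}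
    (h : PSTAt M (density (Pi.single a 1)) (density (Pi.single b 1)) τ)
    {v : V → ℝ} {μ : ℝ} (hv : M *ᵥ v = μ • v) : v a ^ 2 = v b ^ 2 := by
  have := h.eigenvector_mul hM hv hv
  simp only [sub_self, mul_zero, Complex.ofReal_zero, zero_mul, Complex.exp_zero, one_mul] at this
  rw [sq, sq]
  exact (Complex.ofReal_injective this).symm

/-- The ratio condition: eigenvalue differences in the eigenvalue support of the initial vertex
are integer multiples of `π / τ`. -/
theorem PSTAt.exists_int_eigenvalue_sub {M : Matrix V V ℝ} (hM : M.IsSymm) {a b : V} {τ : ℝ}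
    (h : PSTAt M (density (Pi.single a 1)) (density (Pi.single b 1)) τ)
    {v w : V → ℝ} {μ ν : ℝ} (hv : M *ᵥ v = μ • v) (hw : M *ᵥ w = ν • w)
    (hva : v a ≠ 0) (hwa : w a ≠ 0) : ∃ m : ℤ, μ - ν = m * (Real.pi / τ) := by
  have him := congrArg Complex.im (h.eigenvector_mul hM hv hw)
  rw [Complex.ofReal_im, Complex.im_mul_ofReal, Complex.exp_ofReal_mul_I_im] at him
  have hsin : Real.sin (τ * (μ - ν)) = 0 :=
    (mul_eq_zero.mp him.symm).resolve_right (mul_ne_zero hva hwa)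
  obtain ⟨m, hm⟩ := Real.sin_eq_zero_iff.mp hsin
  have := h.1.ne'
  refine ⟨m, ?_⟩
  field_simp
  linarith

end TransitionMatrix

/-! ### Sine waves on the path -/

section Path

theorem pathQLaplacian_eq (q : ℝ) (n : ℕ) (ω₁ ω₂ : ℝ) :
    pathQLaplacian q n ω₁ ω₂ = (q ^ 2) • degreeMatrix (pathAdj n) (endPotential n ω₁ ω₂)
      - q • pathAdj n - (q ^ 2 - 1) • (1 : Matrix (Fin n) (Fin n) ℝ) := by
  rw [pathQLaplacian, qLaplacian, laplacian]
  module

theorem pathQLaplacian_isSymm (q : ℝ) (n : ℕ) (ω₁ ω₂ : ℝ) :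
    (pathQLaplacian q n ω₁ ω₂).IsSymm := by
  have hA : (pathAdj n)ᵀ = pathAdj n := by
    rw [pathAdj, SimpleGraph.transpose_adjMatrix]
  rw [IsSymm, pathQLaplacian_eq, degreeMatrix]
  simp [hA]

theorem sum_pathAdj_mul (n : ℕ) (v : Fin n) (f : ℤ → ℝ) :
    ∑ w, pathAdj n v w * f w.val =
      (if v.val = 0 then 0 else f (v.val - 1)) + (if v.val + 1 = n then 0 else f (v.val + 1)) := by
  have hterm : ∀ w : Fin n, pathAdj n v w * f w.val =
      (if w.val + 1 = v.val then f (v.val - 1) else 0)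
        + (if v.val + 1 = w.val then f (v.val + 1) else 0) := by
    intro w
    rw [pathAdj, SimpleGraph.adjMatrix_apply]
    simp only [SimpleGraph.pathGraph_adj]
    by_cases h₁ : w.val + 1 = v.val
    · have h₂ : ¬ v.val + 1 = w.val := by omega
      simp [h₁, h₂, show (v.val : ℤ) - 1 = w.val by omega]
    · by_cases h₂ : v.val + 1 = w.val
      · simp [h₁, h₂, show (v.val : ℤ) + 1 = w.val by omega]
      · simp [h₁, h₂]
  simp only [hterm, Finset.sum_add_distrib]
  have hlt := v.isLt
  congr 1
  · split_ifs with h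
    · exact Finset.sum_eq_zero fun w _ => if_neg (by omega)
    · rw [Finset.sum_eq_single (⟨v.val - 1, by omega⟩ : Fin n)]
      · exact if_pos (by simp; omega)
      · exact fun w _ hw => if_neg fun h' => hw (Fin.ext (by simp; omega))
      · simp
  · split_ifs with h
    · exact Finset.sum_eq_zero fun w _ => if_neg (by omega)
    · rw [Finset.sum_eq_single (⟨v.val + 1, by omega⟩ : Fin n)]
      · exact if_pos rfl
      · exact fun w _ hw => if_neg fun h' => hw (Fin.ext (by simp; omega))
      · simp

/-- A sequence with `f (k - 1) + f (k + 1) = c * f k` and the boundary conditions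
`f (-1) = -ε₁ * f 0` and `f n = -ε₂ * f (n - 1)` restricts to an eigenvector of the `q`-Laplacian
matrix of `P_n(1 + ε₁ / q, 1 + ε₂ / q)`. -/
theorem pathQLaplacian_mulVec {q : ℝ} (hq : q ≠ 0) {n : ℕ} {ε₁ ε₂ c : ℝ} {f : ℤ → ℝ}
    (hf : ∀ k, f (k - 1) + f (k + 1) = c * f k) (h0 : f (-1) = -ε₁ * f 0)
    (hn : f n = -ε₂ * f (n - 1)) :
    pathQLaplacian q n (1 + ε₁ / q) (1 + ε₂ / q) *ᵥ (fun k : Fin n => f k.val) =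
      (q ^ 2 + 1 - q * c) • fun k : Fin n => f k.val := by
  funext v
  have hA : (pathAdj n *ᵥ fun k : Fin n => f k.val) v =
      (if v.val = 0 then 0 else f (v.val - 1)) + (if v.val + 1 = n then 0 else f (v.val + 1)) :=
    sum_pathAdj_mul n v f
  have hdeg : ∑ w, pathAdj n v w =
      (if v.val = 0 then 0 else 1) + (if v.val + 1 = n then 0 else 1) := by
    simpa using sum_pathAdj_mul n v fun _ => 1
  have hfv := hf v.val
  rw [pathQLaplacian_eq, degreeMatrix, sub_mulVec, sub_mulVec, smul_mulVec, smul_mulVec,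
    smul_mulVec, add_mulVec, one_mulVec]
  simp only [Pi.sub_apply, Pi.smul_apply, Pi.add_apply, mulVec_diagonal, smul_eq_mul, hA, hdeg,
    endPotential]
  -- The potential `1` restores degree 2 at an end; the extra `q * ε` on the diagonal plays the role
  -- of the ghost neighbour.
  have e0 : v.val = 0 → f ((v.val : ℤ) - 1) = -ε₁ * f v.val := by
    intro h; simpa [h] using h0
  have en : v.val + 1 = n → f ((v.val : ℤ) + 1) = -ε₂ * f v.val := by
    intro h; simpa [← h] using hn
  split_ifs with h₁ h₂ h₂
  · rw [e0 h₁, en h₂] at hfv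
    field_simp
    linear_combination (-q) * hfv
  · rw [e0 h₁] at hfv
    field_simp
    linear_combination (-q) * hfv
  · rw [en h₂] at hfv
    field_simp
    linear_combination (-q) * hfv
  · linear_combination (-q) * hfv

/-- Sine waves satisfying the boundary conditions are eigenvectors. -/
theorem pathQLaplacian_mulVec_sin {q : ℝ} (hq : q ≠ 0) {n : ℕ} {ε₁ ε₂ x α : ℝ}
    (h0 : Real.sin (x * (-1 + α)) = -ε₁ * Real.sin (x * α))
    (hn : Real.sin (x * (n + α)) = -ε₂ * Real.sin (x * (n - 1 + α))) :
    pathQLaplacian q n (1 + ε₁ / q) (1 + ε₂ / q) *ᵥ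
        (fun k : Fin n => Real.sin (x * (k.val + α))) =
      (q ^ 2 + 1 - q * (2 * Real.cos x)) • fun k : Fin n => Real.sin (x * (k.val + α)) := by
  have := pathQLaplacian_mulVec hq (n := n) (ε₁ := ε₁) (ε₂ := ε₂) (c := 2 * Real.cos x)
    (f := fun k : ℤ => Real.sin (x * (k + α))) ?_ ?_ ?_
  · simpa using this
  · intro k
    have h₁ : x * (((k - 1 : ℤ) : ℝ) + α) = x * (k + α) - x := by push_cast; ring
    have h₂ : x * (((k + 1 : ℤ) : ℝ) + α) = x * (k + α) + x := by push_cast; ring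
    simp only [h₁, h₂]
    rw [Real.sin_sub, Real.sin_add]
    ring
  · simpa using h0
  · simpa using hn

/-- The ratio condition for two sine waves, in terms of the eigenvalues `2 cos x` of the path. -/
theorem exists_forall_sin_eigenvalue_sub {q : ℝ} (hq : q ≠ 0) {n : ℕ} {ε₁ ε₂ α : ℝ}
    {a b : Fin n} {τ : ℝ}
    (h : PSTAt (pathQLaplacian q n (1 + ε₁ / q) (1 + ε₂ / q)) (density (Pi.single a 1))
      (density (Pi.single b 1)) τ) :
    ∃ c : ℝ, ∀ x y : ℝ,
      Real.sin (x * (-1 + α)) = -ε₁ * Real.sin (x * α) →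
      Real.sin (x * (n + α)) = -ε₂ * Real.sin (x * (n - 1 + α)) →
      Real.sin (y * (-1 + α)) = -ε₁ * Real.sin (y * α) →
      Real.sin (y * (n + α)) = -ε₂ * Real.sin (y * (n - 1 + α)) →
      Real.sin (x * (a.val + α)) ≠ 0 → Real.sin (y * (a.val + α)) ≠ 0 →
      ∃ m : ℤ, 2 * Real.cos x - 2 * Real.cos y = m * c := by
  refine ⟨-(Real.pi / τ) / q, fun x y hx hx' hy hy' hxa hya => ?_⟩
  obtain ⟨m, hm⟩ := h.exists_int_eigenvalue_sub (pathQLaplacian_isSymm _ _ _ _)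
    (pathQLaplacian_mulVec_sin hq hx hx') (pathQLaplacian_mulVec_sin hq hy hy') hxa hya
  refine ⟨m, ?_⟩
  rw [mul_div_assoc', eq_div_iff hq]
  linear_combination -hm

end Path

/-! ### Rational relations for `2 cos x` -/

section Arithmetic

theorem _root_.Irrational.eq_zero_of_mul_add_eq_zero {l : ℝ} (hl : Irrational l) {r s : ℚ}
    (h : r * l + s = 0) : r = 0 ∧ s = 0 := by
  have hr : r = 0 := by
    by_contra hr
    refine hl ⟨-s / r, ?_⟩
    have : (r : ℝ) ≠ 0 := by exact_mod_cast hr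
    push_cast
    rw [div_eq_iff this]
    linarith
  subst hr
  exact ⟨rfl, by simpa using h⟩

theorem irrational_two_mul_cos_pi_div {m : ℕ} (hm : 4 ≤ m) :
    Irrational (2 * Real.cos (Real.pi / m)) := by
  have hden : (1 / (m : ℚ)).den = m := by
    rw [one_div, Rat.inv_natCast_den_of_pos (by omega)]
  have h := irrational_cos_rat_mul_pi (r := 1 / (m : ℚ)) (by omega)
  have hx : ((1 / (m : ℚ) : ℚ) : ℝ) * Real.pi = Real.pi / m := by push_cast; ring
  rw [hx] at h
  exact_mod_cast h.ratCast_mul (q := 2) two_ne_zero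

/-- The differences of `l, -l, l₂, l₃` cannot be commensurable, where `l₂, l₃` are the Chebyshev
conjugates `2 cos 2x, 2 cos 3x` of `l = 2 cos x`. -/
theorem false_of_sq_sub_two_of_cube {l : ℝ} (hl : Irrational l) (h2 : l ^ 2 ≠ 2) {r s : ℚ}
    (hr : l ^ 2 - 2 = r * l) (hs : l ^ 3 - 3 * l = s * l) : False := by
  have hs' : l ^ 2 = s + 3 := mul_right_cancel₀ hl.ne_zero (by linear_combination hs)
  obtain ⟨h₁, -⟩ := hl.eq_zero_of_mul_add_eq_zero (r := r) (s := -1 - s)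
    (by push_cast; linear_combination -hr + hs')
  rw [h₁] at hr
  apply h2
  push_cast at hr
  linarith

theorem false_of_sq_sub_two_of_fourth {l : ℝ} (hl : Irrational l) {r s : ℚ}
    (hr : l ^ 2 - 2 = r * l) (hs : l ^ 4 - 4 * l ^ 2 + 2 = s * l) : False := by
  obtain ⟨-, h₂⟩ := hl.eq_zero_of_mul_add_eq_zero (r := r ^ 3 - s) (s := 2 * r ^ 2 - 2)
    -- Remainder of the quartic modulo `l ^ 2 - r * l - 2`.
    (by push_cast; linear_combination hs - (l ^ 2 + r * l + r ^ 2 - 2) * hr)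
  have h₃ : (r - 1) * (r + 1) = 0 := by linear_combination h₂ / 2
  have hn2 : l ≠ 2 := by exact_mod_cast hl.ne_nat 2
  have hn2' : l ≠ -2 := by exact_mod_cast hl.ne_int (-2)
  have hn1 : l ≠ 1 := hl.ne_one
  have hn1' : l ≠ -1 := by exact_mod_cast hl.ne_int (-1)
  rcases mul_eq_zero.mp h₃ with h | h
  · have : (l - 2) * (l + 1) = 0 := by
      rw [sub_eq_zero.mp h] at hr; push_cast at hr; linear_combination hr
    rcases mul_eq_zero.mp this with h | h
    · exact hn2 (by linarith)
    · exact hn1' (by linarith)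
  · have : (l + 2) * (l - 1) = 0 := by
      rw [eq_neg_of_add_eq_zero_left h] at hr; push_cast at hr; linear_combination hr
    rcases mul_eq_zero.mp this with h | h
    · exact hn2' (by linarith)
    · exact hn1 (by linarith)

theorem false_of_sq_of_sub_one_sq {l : ℝ} (hl : Irrational l) (h0 : 0 < l) (h2 : l < 2) {r s : ℚ}
    (hr : l ^ 2 = r * (l + 2)) (hs : (l - 1) ^ 2 = s) : False := by
  obtain ⟨h₁, -⟩ := hl.eq_zero_of_mul_add_eq_zero (r := r - 2) (s := 2 * r + 1 - s)
    (by push_cast; linear_combination hs - hr)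
  -- Now `l ^ 2 = 2 * l + 4`, whose roots `1 ± √5` lie outside `(0, 2)`.
  rw [sub_eq_zero.mp h₁] at hr
  push_cast at hr
  nlinarith

theorem false_of_sq_of_sq_sub_two_sq {l : ℝ} (hl : Irrational l) {r s : ℚ}
    (hr : l ^ 2 = r * (l + 2)) (hs : (l ^ 2 - 2) ^ 2 = s * (l + 2)) : False := by
  obtain ⟨h₁, h₂⟩ := hl.eq_zero_of_mul_add_eq_zero (r := r ^ 3 + 4 * r ^ 2 - 4 * r - s)
    (s := 2 * r ^ 3 + 4 * (r - 1) ^ 2 - 2 * s)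
    (by push_cast; linear_combination hs - (l ^ 2 + r * (l + 2) - 4 + r ^ 2) * hr)
  -- This combination eliminates both `s` and the cubic term.
  have h₃ : (r - 1) * (r + 1) = 0 := by linear_combination h₁ / 2 - h₂ / 4
  have hn2 : l ≠ 2 := by exact_mod_cast hl.ne_nat 2
  have hn1' : l ≠ -1 := by exact_mod_cast hl.ne_int (-1)
  rcases mul_eq_zero.mp h₃ with h | h
  · have : (l - 2) * (l + 1) = 0 := by
      rw [sub_eq_zero.mp h] at hr; push_cast at hr; linear_combination hr
    rcases mul_eq_zero.mp this with h | h
    · exact hn2 (by linarith)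
    · exact hn1' (by linarith)
  · rw [eq_neg_of_add_eq_zero_left h] at hr
    push_cast at hr
    nlinarith [sq_nonneg (l + 1 / 2)]

theorem cos_four_mul (x : ℝ) :
    Real.cos (4 * x) = 8 * Real.cos x ^ 4 - 8 * Real.cos x ^ 2 + 1 := by
  rw [show 4 * x = 2 * (2 * x) by ring, Real.cos_two_mul, Real.cos_two_mul]
  ring

/-- In `[0, π]` the square of the sine equals 1 only at `π / 2`. This excludes the middle vertex as
a source. -/
theorem cos_ne_zero_of_sin_sq_eq {θ φ : ℝ} (hθ : θ ∈ Set.Icc 0 Real.pi)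
    (hφ : φ ∈ Set.Icc 0 Real.pi) (hne : θ ≠ φ) (h : Real.sin θ ^ 2 = Real.sin φ ^ 2) :
    Real.cos θ ≠ 0 := by
  intro hc
  refine hne (Real.injOn_cos hθ hφ ?_)
  have h₁ := Real.sin_sq_add_cos_sq θ
  have h₂ := Real.sin_sq_add_cos_sq φ
  rw [hc] at h₁ ⊢
  exact (pow_eq_zero_iff two_ne_zero).mp (by linarith : Real.cos φ ^ 2 = 0) |>.symm

theorem sin_two_mul_ne_zero {θ : ℝ} (hs : Real.sin θ ≠ 0) (hc : Real.cos θ ≠ 0) :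
    Real.sin (2 * θ) ≠ 0 := by
  rw [Real.sin_two_mul]
  exact mul_ne_zero (mul_ne_zero two_ne_zero hs) hc

theorem sin_three_mul_ne_zero_or_sin_four_mul_ne_zero {θ : ℝ} (hs : Real.sin θ ≠ 0)
    (hc : Real.cos θ ≠ 0) : Real.sin (3 * θ) ≠ 0 ∨ Real.sin (4 * θ) ≠ 0 := by
  by_contra! h
  obtain ⟨h3, h4⟩ := h
  rw [show 4 * θ = 2 * (2 * θ) by ring, Real.sin_two_mul, Real.cos_two_mul] at h4
  have h4' := (mul_eq_zero.mp h4).resolve_left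
    (mul_ne_zero two_ne_zero (sin_two_mul_ne_zero hs hc))
  rw [Real.sin_three_mul] at h3
  have h3' : 3 - 4 * Real.sin θ ^ 2 = 0 :=
    (mul_eq_zero.mp (by linear_combination h3 : Real.sin θ * (3 - 4 * Real.sin θ ^ 2) = 0)
      ).resolve_left hs
  linarith [Real.sin_sq_add_cos_sq θ]

end Arithmetic

/-! ### The three families of potentials -/

section NoTransfer

open Real

theorem not_exhibitsVertexPST_mixed {q : ℝ} (hq : q ≠ 0) (n : ℕ) :
    ¬ ExhibitsVertexPST (pathQLaplacian q n (1 + 1 / q) 1) := by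
  rintro ⟨a, b, hab, τ, h⟩
  -- The phase `-n` makes the wave vanish at the right ghost vertex; the left condition holds
  -- because `x * (2 * n + 1) = 2 * n * π`.
  set x : ℝ := π - π / (2 * n + 1) with hx
  have hsin : ∀ k : Fin n, sin (x * (k.val + -(n : ℝ))) ^ 2 =
      sin (π / (2 * n + 1) * (n - k.val)) ^ 2 := by
    intro k
    have : x * (k.val + -(n : ℝ)) =
        -(((n - k.val : ℕ) : ℝ) * π - π / (2 * n + 1) * (n - k.val)) := by
      rw [hx, Nat.cast_sub k.isLt.le]; ring
    rw [this, sin_neg, sin_nat_mul_pi_sub, neg_neg, mul_pow, ← pow_mul, mul_comm _ 2, pow_mul,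
      neg_one_sq, one_pow, one_mul]
  have heig := pathQLaplacian_mulVec_sin hq (n := n) (ε₁ := 1) (ε₂ := 0) (x := x)
    (α := -(n : ℝ)) ?_ (by simp)
  · rw [zero_div, add_zero] at heig
    have hsq := h.eigenvector_sq (pathQLaplacian_isSymm _ _ _ _) heig
    simp only [hsin] at hsq
    have hmem : ∀ k : Fin n, 0 ≤ π / (2 * n + 1) * (n - k.val) ∧
        π / (2 * n + 1) * (n - k.val) ≤ π / 2 := by
      intro k
      have hk : (k.val : ℝ) ≤ n := by exact_mod_cast k.isLt.le
      have hk0 : (0 : ℝ) ≤ k.val := by positivity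
      refine ⟨mul_nonneg (by positivity) (by linarith), ?_⟩
      rw [div_mul_eq_mul_div, div_le_div_iff₀ (by positivity) two_pos]
      nlinarith [pi_pos]
    have hnn : ∀ k : Fin n, 0 ≤ sin (π / (2 * n + 1) * (n - k.val)) := fun k =>
      sin_nonneg_of_nonneg_of_le_pi (hmem k).1 (by linarith [(hmem k).2, pi_pos])
    have heq := (sq_eq_sq₀ (hnn a) (hnn b)).mp hsq
    have hang := injOn_sin ⟨by linarith [(hmem a).1, pi_pos], (hmem a).2⟩
      ⟨by linarith [(hmem b).1, pi_pos], (hmem b).2⟩ heq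
    have hval := mul_left_cancel₀ (by positivity : π / (2 * (n : ℝ) + 1) ≠ 0) hang
    refine hab (Fin.ext ?_)
    exact_mod_cast (by linarith : (a.val : ℝ) = b.val)
  · have key : ∀ y : ℝ, sin (n * π + y) = -sin (n * π - y) := by
      intro y
      rw [sin_add, sin_sub, sin_nat_mul_pi]
      ring
    have hright : x * (-(n : ℝ)) = -(n * π - (π / 2 - (π / (2 * n + 1)) / 2)) := by
      rw [hx]; field_simp; ring
    have hleft : x * (-1 + -(n : ℝ)) = -(n * π + (π / 2 - (π / (2 * n + 1)) / 2)) := by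
      rw [hx]; field_simp; ring
    rw [hright, hleft, sin_neg, sin_neg, key]
    ring

theorem not_exhibitsVertexPST_one_one {q : ℝ} (hq : q ≠ 0) {n : ℕ} (hn : 4 ≤ n) :
    ¬ ExhibitsVertexPST (pathQLaplacian q n 1 1) := by
  rintro ⟨a, b, hab, τ, h⟩
  have hM : pathQLaplacian q n 1 1 = pathQLaplacian q n (1 + 0 / q) (1 + 0 / q) := by simp
  rw [hM] at h
  set x : ℝ := π / (n + 1) with hx
  have hxn : x * (n + 1) = π := by rw [hx]; field_simp
  have hx0 : 0 < x := by positivity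
  have hmem : ∀ k : Fin n, 0 < x * (k.val + 1) ∧ x * (k.val + 1) < π := by
    intro k
    have hk : (k.val : ℝ) < n := by exact_mod_cast k.isLt
    exact ⟨by positivity, by rw [← hxn]; gcongr⟩
  have hleft : ∀ y : ℝ, sin (y * (-1 + 1)) = -0 * sin (y * 1) := by simp
  have hright : ∀ y : ℝ, sin (y * (n + 1)) = 0 →
      sin (y * (n + 1)) = -0 * sin (y * (n - 1 + 1)) := by simp
  have hwave : ∀ j : ℕ, sin (j * x * (n + 1)) = 0 := by
    intro j; rw [mul_assoc, hxn, sin_nat_mul_pi]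
  have hsq := h.eigenvector_sq (pathQLaplacian_isSymm _ _ _ _)
    (pathQLaplacian_mulVec_sin hq (hleft x) (hright x (by simpa using hwave 1)))
  have hs : sin (x * (a.val + 1)) ≠ 0 := (sin_pos_of_pos_of_lt_pi (hmem a).1 (hmem a).2).ne'
  have hc : cos (x * (a.val + 1)) ≠ 0 := by
    refine cos_ne_zero_of_sin_sq_eq ⟨(hmem a).1.le, (hmem a).2.le⟩
      ⟨(hmem b).1.le, (hmem b).2.le⟩ (fun heq => hab (Fin.ext ?_)) hsq
    have := mul_left_cancel₀ hx0.ne' heq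
    exact_mod_cast (by linarith : (a.val : ℝ) = b.val)
  obtain ⟨c, hratio⟩ := exists_forall_sin_eigenvalue_sub hq (α := 1) h
  have hirr : Irrational (2 * cos x) := by
    have := irrational_two_mul_cos_pi_div (m := n + 1) (by omega)
    push_cast at this
    exact this
  -- The mirror frequency replaces `l` by `-l`, so `2 * l = m₁ * c` and every difference is a
  -- rational multiple of `l`.
  obtain ⟨m₁, hm₁⟩ := hratio x (π - x) (hleft _) (hright _ (by simpa using hwave 1)) (hleft _)
    (hright _ (by
      rw [sub_mul, hxn, mul_add, mul_one, add_sub_cancel_right, mul_comm, sin_nat_mul_pi])) hs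
    (by
      have : (π - x) * (a.val + 1) = ((a.val + 1 : ℕ) : ℝ) * π - x * (a.val + 1) := by
        push_cast; ring
      rw [this, sin_nat_mul_pi_sub]
      simpa using hs)
  rw [cos_pi_sub] at hm₁
  have hm0 : (m₁ : ℝ) ≠ 0 := by
    intro h0
    rw [h0] at hm₁
    exact hirr.ne_zero (by linarith)
  have hrat : ∀ j : ℕ, sin (j * (x * (a.val + 1))) ≠ 0 →
      ∃ r : ℚ, 2 * cos (j * x) = r * (2 * cos x) := by
    intro j hj
    obtain ⟨m, hm⟩ := hratio x (j * x) (hleft _) (hright _ (by simpa using hwave 1)) (hleft _)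
      (hright _ (hwave j)) hs (by rwa [mul_assoc])
    refine ⟨1 - 2 * m / m₁, ?_⟩
    push_cast
    field_simp
    linear_combination (m * hm₁ - m₁ * hm) / 2
  obtain ⟨r, hr⟩ := hrat 2 (by exact_mod_cast sin_two_mul_ne_zero hs hc)
  push_cast at hr
  rw [cos_two_mul] at hr
  rcases sin_three_mul_ne_zero_or_sin_four_mul_ne_zero hs hc with h' | h'
  · obtain ⟨s, hs'⟩ := hrat 3 (by exact_mod_cast h')
    push_cast at hs'
    rw [cos_three_mul] at hs'
    refine false_of_sq_sub_two_of_cube hirr ?_ (r := r) (s := s) (by linear_combination hr)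
      (by linear_combination hs')
    -- Here `x ≤ π / 5`, which rules out `l ^ 2 = 2`.
    have hlt : cos (π / 4) < cos x := by
      refine cos_lt_cos_of_nonneg_of_le_pi_div_two hx0.le (by linarith [pi_pos]) ?_
      rw [hx]
      have : (4 : ℝ) ≤ n := by exact_mod_cast hn
      gcongr
      linarith
    rw [cos_pi_div_four] at hlt
    nlinarith [sq_sqrt (show (0 : ℝ) ≤ 2 by norm_num), sqrt_nonneg (2 : ℝ)]
  · obtain ⟨s, hs'⟩ := hrat 4 (by exact_mod_cast h')
    push_cast at hs'
    rw [cos_four_mul] at hs'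
    exact false_of_sq_sub_two_of_fourth hirr (r := r) (s := s) (by linear_combination hr)
      (by linear_combination hs')

theorem not_exhibitsVertexPST_one_add_one_add {q : ℝ} (hq : q ≠ 0) {n : ℕ} (hn : 4 ≤ n) :
    ¬ ExhibitsVertexPST (pathQLaplacian q n (1 + 1 / q) (1 + 1 / q)) := by
  rintro ⟨a, b, hab, τ, h⟩
  have hn0 : (n : ℝ) ≠ 0 := by positivity
  set x : ℝ := π / n with hx
  have hxn : x * n = π := by rw [hx]; field_simp
  have hx0 : 0 < x := by positivity
  have hmem : ∀ k : Fin n, 0 < x * (k.val + 1 / 2) ∧ x * (k.val + 1 / 2) < π := by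
    intro k
    have hk : (k.val : ℝ) + 1 ≤ n := by exact_mod_cast k.isLt
    exact ⟨by positivity, by rw [← hxn]; gcongr; linarith⟩
  have hleft : ∀ y : ℝ, sin (y * (-1 + 1 / 2)) = -1 * sin (y * (1 / 2)) := by
    intro y
    rw [show y * (-1 + 1 / 2) = -(y * (1 / 2)) by ring, sin_neg, neg_one_mul]
  have hright : ∀ y : ℝ, sin (y * n) = 0 →
      sin (y * (n + 1 / 2)) = -1 * sin (y * (n - 1 + 1 / 2)) := by
    intro y hy
    rw [show y * (n + 1 / 2) = y * n + y / 2 by ring,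
      show y * (n - 1 + 1 / 2) = y * n - y / 2 by ring, sin_add, sin_sub, hy]
    ring
  have hwave : ∀ j : ℕ, sin (j * x * n) = 0 := by
    intro j; rw [mul_assoc, hxn, sin_nat_mul_pi]
  have hsq := h.eigenvector_sq (pathQLaplacian_isSymm _ _ _ _)
    (pathQLaplacian_mulVec_sin hq (hleft x) (hright x (by simpa using hwave 1)))
  have hs : sin (x * (a.val + 1 / 2)) ≠ 0 :=
    (sin_pos_of_pos_of_lt_pi (hmem a).1 (hmem a).2).ne'
  have hc : cos (x * (a.val + 1 / 2)) ≠ 0 := by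
    refine cos_ne_zero_of_sin_sq_eq ⟨(hmem a).1.le, (hmem a).2.le⟩
      ⟨(hmem b).1.le, (hmem b).2.le⟩ (fun heq => hab (Fin.ext ?_)) hsq
    have := mul_left_cancel₀ hx0.ne' heq
    exact_mod_cast (by linarith : (a.val : ℝ) = b.val)
  obtain ⟨c, hratio⟩ := exists_forall_sin_eigenvalue_sub hq (α := 1 / 2) h
  have hirr : Irrational (2 * cos x) := irrational_two_mul_cos_pi_div hn
  have hne : 2 * cos x + 2 ≠ 0 := by
    intro h0
    exact hirr.ne_int (-2) (by push_cast; linarith)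
  have hdiff : ∀ j : ℕ, sin (j * (x * (a.val + 1 / 2))) ≠ 0 →
      ∃ m : ℤ, 2 * cos (j * x) + 2 = m * c := by
    intro j hj
    -- The wave of frequency `π` is `(-1) ^ k`, which never vanishes; it serves as the reference,
    -- with `2 cos π = -2`.
    obtain ⟨m, hm⟩ := hratio (j * x) π (hleft _) (hright _ (hwave j)) (hleft _)
      (hright _ (by rw [mul_comm, sin_nat_mul_pi])) (by rwa [mul_assoc])
      (by
        rw [show π * ((a.val : ℝ) + 1 / 2) = a.val * π + π / 2 by ring, sin_add_pi_div_two]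
        simp [cos_nat_mul_pi])
    exact ⟨m, by rw [← hm, cos_pi]; ring⟩
  obtain ⟨m₁, hm₁⟩ := hdiff 1 (by simpa using hs)
  rw [Nat.cast_one, one_mul] at hm₁
  have hm0 : (m₁ : ℝ) ≠ 0 := by
    intro h0
    rw [h0, zero_mul] at hm₁
    exact hne hm₁
  have hrat : ∀ j : ℕ, sin (j * (x * (a.val + 1 / 2))) ≠ 0 →
      ∃ r : ℚ, 2 * cos (j * x) + 2 = r * (2 * cos x + 2) := by
    intro j hj
    obtain ⟨m, hm⟩ := hdiff j hj
    refine ⟨m / m₁, ?_⟩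
    rw [hm, hm₁]
    push_cast
    field_simp
  obtain ⟨r, hr⟩ := hrat 2 (by exact_mod_cast sin_two_mul_ne_zero hs hc)
  push_cast at hr
  rw [cos_two_mul] at hr
  rcases sin_three_mul_ne_zero_or_sin_four_mul_ne_zero hs hc with h' | h'
  · obtain ⟨s, hs'⟩ := hrat 3 (by exact_mod_cast h')
    push_cast at hs'
    rw [cos_three_mul] at hs'
    have hxlt : x < π / 2 := by
      rw [hx]
      have : (4 : ℝ) ≤ n := by exact_mod_cast hn
      gcongr
      linarith
    have hpos : 0 < cos x := cos_pos_of_mem_Ioo ⟨by linarith [pi_pos], hxlt⟩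
    have hlt : 2 * cos x < 2 := by
      refine lt_of_le_of_ne (by linarith [cos_le_one x]) ?_
      exact_mod_cast hirr.ne_nat 2
    -- `2 cos 3x + 2 = (l - 1) ^ 2 * (l + 2)`, and `l + 2` cancels.
    refine false_of_sq_of_sub_one_sq hirr (by linarith) hlt (r := r) (s := s)
      (by linear_combination hr) (mul_right_cancel₀ hne (by linear_combination hs'))
  · obtain ⟨s, hs'⟩ := hrat 4 (by exact_mod_cast h')
    push_cast at hs'
    rw [cos_four_mul] at hs'
    exact false_of_sq_of_sq_sub_two_sq hirr (r := r) (s := s) (by linear_combination hr)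
      (by linear_combination hs')

end NoTransfer

end QLaplacianWalk

theorem theorem3p10 (q : ℝ) (hq : q ≠ 0) (n : ℕ) :
    (2 ≤ n → ¬ QLaplacianWalk.ExhibitsVertexPST
      (QLaplacianWalk.pathQLaplacian q n (1 + 1 / q) 1)) ∧
    (4 ≤ n → ¬ QLaplacianWalk.ExhibitsVertexPST
      (QLaplacianWalk.pathQLaplacian q n 1 1)) ∧
    (5 ≤ n → ¬ QLaplacianWalk.ExhibitsVertexPST
      (QLaplacianWalk.pathQLaplacian q n (1 + 1 / q) (1 + 1 / q))) :=
  ⟨fun _ => QLaplacianWalk.not_exhibitsVertexPST_mixed hq n,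
    fun hn => QLaplacianWalk.not_exhibitsVertexPST_one_one hq hn,
    fun hn => QLaplacianWalk.not_exhibitsVertexPST_one_add_one_add hq (by omega)⟩
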